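/- A Young function is a non-negative convex function $V:\mathbb R\to\mathbb R^+$ which vanishes only at $0$ (that is, $V(x)=0$ if and only if $x=0$; no symmetry is assumed). For an integer $n\ge 1$ and $E\ge 0$ write $$B^n_{V/E}=\Big\{x\in\mathbb R^n:\ \sum_{i=1}^n V(x_i)\le E\Big\},\qquad \mathrm{Level}_n(V)=\Big\{E\ge 0:\ e^{-E}\,\mathrm{Vol}_n\big(B^n_{V/E}\big)\ \ge\ \frac1e\,\frac{n^n e^{-n}}{n!}\Big\},$$ where $\mathrm{Vol}_n$ is Lebesgue measure on $\mathbb R^n$. **Proposition.** Let $V$ be a Young function such that $d\mu(x)=e^{-V(x)}\,dx$ is a probability measure on $\mathbb R$. Let $m_1=\int V\,d\mu$ be the mean of $V$ with respect to $\mu$, let $\sigma_1^2=\int (V-m_1)^2\,d\mu$ be its variance, and let $\sigma_1\ge 0$. Then for every $\varepsilon\in(0,1)$ there exists an integer $n_0=n_0(V,\varepsilon)$ such that for all $n\ge n_0$, $$\Big[m_1 n-\sigma_1(1-\varepsilon)\sqrt{2n}\,,\ m_1 n+\sigma_1(1-\varepsilon)\sqrt{2n}\Big]\subset \mathrm{Level}_n(V).$$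 -/

import Mathlib

open MeasureTheory ProbabilityTheory

/-- A Young function: a non-negative (finite) convex function on `ℝ` which vanishes exactly at `0`.
No symmetry is assumed. -/
structure IsYoungFunction (V : ℝ → ℝ) : Prop where
  convexOn : ConvexOn ℝ Set.univ V
  nonneg : ∀ x, 0 ≤ V x
  eq_zero_iff : ∀ x, V x = 0 ↔ x = 0

/-- The Orlicz ball `B^n_{V/E} = {x ∈ ℝⁿ : ∑ i, V (x i) ≤ E}`. -/
def orliczBall (V : ℝ → ℝ) (n : ℕ) (E : ℝ) : Set (Fin n → ℝ) :=
  {x | ∑ i, V (x i) ≤ E}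

/-- `Level_n(V)`: the set of `E ≥ 0` with `e^{-E} Vol_n(B^n_{V/E}) ≥ (1/e) n^n e^{-n} / n!`.
The inequality is between extended non-negative numbers, so no convention on infinite volumes
is involved. -/
def levelSet (V : ℝ → ℝ) (n : ℕ) : Set ℝ :=
  {E | 0 ≤ E ∧
    ENNReal.ofReal (1 / Real.exp 1 * ((n : ℝ) ^ n * Real.exp (-(n : ℝ)) / (n.factorial : ℝ)))
      ≤ ENNReal.ofReal (Real.exp (-E)) * volume (orliczBall V n E)}

/-- The measure `e^{-V(x)} dx` on `ℝ`. -/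
noncomputable def gibbsMeasure (V : ℝ → ℝ) : Measure ℝ :=
  volume.withDensity (fun x => ENNReal.ofReal (Real.exp (-V x)))

/-- A Young function is square integrable for `e^{-V(x)} dx`, so its mean and variance under this
measure are genuine. -/
theorem IsYoungFunction.memLp_two {V : ℝ → ℝ} (hV : IsYoungFunction V) :
    MemLp V 2 (gibbsMeasure V) := by
  have hcont : Continuous V := by
    rw [← continuousOn_univ]
    exact hV.convexOn.continuousOn isOpen_univ
  have hV0 : V 0 = 0 := (hV.eq_zero_iff 0).2 rfl
  have pos : ∀ x, x ≠ 0 → 0 < V x := fun x hx =>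
    lt_of_le_of_ne (hV.nonneg x) (fun h => hx ((hV.eq_zero_iff x).1 h.symm))
  obtain ⟨a, ha, ha1, ha2⟩ : ∃ a : ℝ, 0 < a ∧ a ≤ V 1 ∧ a ≤ V (-1) :=
    ⟨min (V 1) (V (-1)), lt_min (pos 1 one_ne_zero) (pos (-1) (by norm_num)),
      min_le_left _ _, min_le_right _ _⟩
  have growth : ∀ x, a * |x| - a ≤ V x := by
    intro x
    rcases le_or_gt |x| 1 with h | h
    · nlinarith [hV.nonneg x]
    · have hx0 : 0 < |x| := by linarith
      have key : ∀ s : ℝ, s * |x| = x → V s ≤ |x|⁻¹ * V x := by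
        intro s hs
        have h1 := hV.convexOn.2 (Set.mem_univ x) (Set.mem_univ (0 : ℝ))
          (inv_nonneg.2 hx0.le) (sub_nonneg.2 (inv_le_one_of_one_le₀ h.le))
          (by ring : |x|⁻¹ + (1 - |x|⁻¹) = 1)
        have h2 : |x|⁻¹ * x = s := by
          calc |x|⁻¹ * x = |x|⁻¹ * (s * |x|) := by rw [hs]
            _ = s := by field_simp
        simpa [hV0, h2] using h1
      have hs : a ≤ |x|⁻¹ * V x := by
        rcases le_total 0 x with h0 | h0
        · exact ha1.trans (key 1 (by rw [abs_of_nonneg h0]; ring))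
        · exact ha2.trans (key (-1) (by rw [abs_of_nonpos h0]; ring))
      have : a * |x| ≤ V x := by
        have := mul_le_mul_of_nonneg_right hs hx0.le
        field_simp at this
        linarith
      linarith
  have hexp : Integrable (fun x : ℝ => Real.exp (-(a / 2) * |x|)) := by
    have hb : 0 < a / 2 := by linarith
    rw [← integrableOn_univ, ← Set.Iic_union_Ioi (a := (0 : ℝ)), integrableOn_union]
    constructor
    · refine (integrableOn_exp_mul_Iic hb 0).congr_fun (fun x hx => ?_) measurableSet_Iic
      simp only [abs_of_nonpos (show x ≤ 0 from hx)]
      ring_nf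
    · refine (exp_neg_integrableOn_Ioi 0 hb).congr_fun (fun x hx => ?_) measurableSet_Ioi
      simp only [abs_of_pos (show 0 < x from hx)]
  have hbound : ∀ x, V x ^ 2 * Real.exp (-V x)
      ≤ 8 * Real.exp (a / 2) * Real.exp (-(a / 2) * |x|) := by
    intro x
    have h1 : V x ^ 2 ≤ 8 * Real.exp (V x / 2) := by
      have := Real.quadratic_le_exp_of_nonneg (x := V x / 2) (by linarith [hV.nonneg x])
      nlinarith [hV.nonneg x]
    calc V x ^ 2 * Real.exp (-V x)
        ≤ 8 * Real.exp (V x / 2) * Real.exp (-V x) := by gcongr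
      _ = 8 * Real.exp (-V x / 2) := by
          rw [mul_assoc, ← Real.exp_add]; ring_nf
      _ ≤ 8 * Real.exp (a / 2 + -(a / 2) * |x|) := by
          gcongr
          linarith [growth x]
      _ = _ := by rw [Real.exp_add]; ring
  have hint : Integrable (fun x => V x ^ 2 * Real.exp (-V x)) := by
    refine (hexp.const_mul (8 * Real.exp (a / 2))).mono' (by fun_prop) ?_
    filter_upwards with x
    rw [Real.norm_of_nonneg (by positivity)]
    exact hbound x
  rw [memLp_two_iff_integrable_sq hcont.aestronglyMeasurable]
  unfold gibbsMeasure
  rw [integrable_withDensity_iff (by fun_prop) (by simp)]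
  refine hint.congr ?_
  filter_upwards with x
  rw [ENNReal.toReal_ofReal (Real.exp_pos _).le]

/-!
# Energy levels of Orlicz balls near the mean

Let `g_n(E) = e^{-E} Vol_n(B_E)`, so that membership in `levelSet V n` is a lower bound on `g_n(E)`.
With `X_i` independent of law `μ = e^{-V} dx` and `T` an independent standard exponential variable,
`g_n` is the probability density of `∑ V(X_i) + T`. A local limit theorem therefore predicts
`g_n(m n + x √n) ≈ e^{-x² / 2σ²} / √(2πσ²n)`, which for `|x| ≤ σ(1 - ε)√2` exceeds
`e⁻¹ / √(2πn)` provided `σ ≤ 1`. That bound in turn dominates the required level, by Stirling's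
lower bound for `n!` (`pow_mul_exp_neg_div_factorial_le`).

The local limit theorem is replaced by the ordinary central limit theorem together with the shape of
`g_n`. By induction on `n`, slicing along one coordinate and applying the one-dimensional
Prékopa–Leindler inequality (`lintegral_rpow_mul_lintegral_rpow_le`) shows that
`E ↦ Vol_n(B_E)` is log-concave (`volume_orliczBall_logConcave`). Hence `g_n` is quasi-concave, and
at a point lying between two windows it is at least the smaller of its averages over them
(`le_volumeDensity_of_le_setLIntegral`). The two windows are taken on either side of the target
interval, each of width proportional to `√n`. Integrating out `T`, which is negligible at that
scale, bounds an average of `g_n` below by the probability that `∑ V(X_i)` falls in a slightly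
shorter window (`pi_gibbsMeasure_le_setLIntegral`), and the central limit theorem evaluates that
probability (`eventually_le_setLIntegral_volumeDensity`).

The bound `σ ≤ 1` (`variance_gibbsMeasure_le_one`) is again Prékopa–Leindler: the function
`α ↦ α ∫ e^{-αV} = ∫ e^{-αV(x/α)} dx` is log-concave because the perspective of `V` is convex, and
comparing its values at `1 ± t` and `1` as `t → 0` bounds the variance.
-/

/-! ### One-dimensional Brunn–Minkowski and Prékopa–Leindler inequalities -/

/-- The compact case: the translates `K + min L` and `max K + L` both lie in `K + L` and overlap in
a single point. -/
theorem IsCompact.volume_add_volume_le {K L C : Set ℝ} (hK : IsCompact K) (hL : IsCompact L)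
    (hK0 : K.Nonempty) (hL0 : L.Nonempty) (h : ∀ x ∈ K, ∀ y ∈ L, x + y ∈ C) :
    volume K + volume L ≤ volume C := by
  obtain ⟨k, hk, hkmax⟩ := hK.exists_isGreatest hK0
  obtain ⟨l, hl, hlmin⟩ := hL.exists_isLeast hL0
  have hKl : volume ((fun x => x + l) '' K) = volume K := by
    rw [Set.image_add_right, measure_preimage_add_right]
  have hkL : volume ((fun y => k + y) '' L) = volume L := by
    rw [Set.image_add_left, measure_preimage_add]
  have hinter : volume ((fun x => x + l) '' K ∩ (fun y => k + y) '' L) = 0 := by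
    refine measure_mono_null ?_ (measure_singleton (k + l))
    rintro _ ⟨⟨x, hx, rfl⟩, ⟨y, hy, hxy⟩⟩
    have h1 := hkmax hx
    have h2 := hlmin hy
    simp only [Set.mem_singleton_iff] at *
    linarith
  have hmeas : MeasurableSet ((fun y => k + y) '' L) :=
    (hL.image (by fun_prop)).isClosed.measurableSet
  rw [← hKl, ← hkL, ← measure_union_add_inter _ hmeas, hinter, add_zero]
  refine measure_mono (Set.union_subset ?_ ?_)
  · rintro _ ⟨x, hx, rfl⟩
    exact h x hx l hl
  · rintro _ ⟨y, hy, rfl⟩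
    exact h k hk y hy

theorem volume_add_volume_le_of_add_mem {A B C : Set ℝ} (hA : MeasurableSet A)
    (hB : MeasurableSet B) (hA0 : A.Nonempty) (hB0 : B.Nonempty)
    (h : ∀ x ∈ A, ∀ y ∈ B, x + y ∈ C) : volume A + volume B ≤ volume C := by
  obtain ⟨a, ha⟩ := hA0
  obtain ⟨b, hb⟩ := hB0
  rw [hA.measure_eq_iSup_isCompact, hB.measure_eq_iSup_isCompact]
  simp_rw [iSup_and']
  refine ENNReal.biSup_add_biSup_le' ⟨∅, by simp⟩ ⟨∅, by simp⟩ ?_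
  rintro K ⟨hKA, hK⟩ L ⟨hLB, hL⟩
  -- a point is inserted because an approximating compact set may be empty
  calc volume K + volume L ≤ volume (insert a K) + volume (insert b L) := by
        gcongr <;> exact Set.subset_insert _ _
    _ ≤ volume C := by
        refine (hK.insert a).volume_add_volume_le (hL.insert b) (Set.insert_nonempty _ _)
          (Set.insert_nonempty _ _) fun x hx y hy => h x ?_ y ?_
        · exact Set.insert_subset ha hKA hx
        · exact Set.insert_subset hb hLB hy

/-- Prékopa–Leindler for functions with supremum `1`, in its stronger arithmetic form: superlevel
sets are compared by Brunn–Minkowski and the layer-cake formula integrates the comparison. -/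
theorem mul_lintegral_add_mul_lintegral_le {f g h : ℝ → ℝ} {a b : ℝ} (ha : 0 < a) (hb : 0 < b)
    (hab : a + b = 1) (hf : Measurable f) (hg : Measurable g) (hh : Measurable h)
    (hf0 : ∀ x, 0 ≤ f x) (hg0 : ∀ x, 0 ≤ g x) (hh0 : ∀ x, 0 ≤ h x)
    (hf1 : IsLUB (Set.range f) 1) (hg1 : IsLUB (Set.range g) 1)
    (H : ∀ x y, f x ^ a * g y ^ b ≤ h (a * x + b * y)) :
    ENNReal.ofReal a * (∫⁻ x, ENNReal.ofReal (f x))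
        + ENNReal.ofReal b * (∫⁻ x, ENNReal.ofReal (g x))
      ≤ ∫⁻ x, ENNReal.ofReal (h x) := by
  rw [lintegral_eq_lintegral_meas_lt volume (.of_forall hf0) hf.aemeasurable,
    lintegral_eq_lintegral_meas_lt volume (.of_forall hg0) hg.aemeasurable,
    lintegral_eq_lintegral_meas_lt volume (.of_forall hh0) hh.aemeasurable]
  have anti : ∀ u : ℝ → ℝ, Measurable fun t : ℝ => volume {x | t < u x} := fun u =>
    Antitone.measurable fun s t hst => measure_mono fun x hx => lt_of_le_of_lt hst hx
  rw [← lintegral_const_mul _ (anti f), ← lintegral_const_mul _ (anti g),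
    ← lintegral_add_left ((anti f).const_mul _)]
  refine setLIntegral_mono (anti h) fun t ht => ?_
  rcases lt_or_ge t 1 with ht1 | ht1
  · obtain ⟨_, ⟨x₀, rfl⟩, hx₀⟩ := (lt_isLUB_iff hf1).1 ht1
    obtain ⟨_, ⟨y₀, rfl⟩, hy₀⟩ := (lt_isLUB_iff hg1).1 ht1
    have scale : ∀ c : ℝ, 0 < c → ∀ s : Set ℝ,
        ENNReal.ofReal c * volume s = volume ((fun x => c * x) '' s) := by
      intro c hc s
      have := Measure.addHaar_smul volume c s
      simp only [Module.finrank_self, pow_one, abs_of_pos hc] at this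
      rw [← this]; rfl
    have hmeas : ∀ c : ℝ, 0 < c → ∀ s : Set ℝ, MeasurableSet s →
        MeasurableSet ((fun x => c * x) '' s) := fun c hc s hs =>
      (MeasurableEquiv.mulLeft₀ c hc.ne').measurableSet_image.2 hs
    rw [scale a ha, scale b hb]
    refine volume_add_volume_le_of_add_mem (hmeas a ha _ (measurableSet_lt measurable_const hf))
      (hmeas b hb _ (measurableSet_lt measurable_const hg)) ⟨_, x₀, hx₀, rfl⟩ ⟨_, y₀, hy₀, rfl⟩ ?_
    rintro _ ⟨x, hx, rfl⟩ _ ⟨y, hy, rfl⟩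
    have ht0 : 0 < t := ht
    calc t = t ^ a * t ^ b := by rw [← Real.rpow_add ht0, hab, Real.rpow_one]
      _ < f x ^ a * g y ^ b := by
          have h1 : t ^ a < f x ^ a := Real.rpow_lt_rpow ht0.le hx ha
          have h2 : t ^ b < g y ^ b := Real.rpow_lt_rpow ht0.le hy hb
          gcongr
      _ ≤ _ := H x y
  · have empty : ∀ u : ℝ → ℝ, IsLUB (Set.range u) 1 → {x | t < u x} = ∅ := fun u hu =>
      Set.eq_empty_of_forall_notMem fun x hx =>
        absurd (hu.1 ⟨x, rfl⟩) (not_le.2 (lt_of_le_of_lt ht1 hx))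
    simp [empty f hf1, empty g hg1]

/-- **Prékopa–Leindler inequality** on the line, for bounded functions. -/
theorem lintegral_rpow_mul_lintegral_rpow_le {f g h : ℝ → ℝ} {a b : ℝ} (ha : 0 < a) (hb : 0 < b)
    (hab : a + b = 1) (hf : Measurable f) (hg : Measurable g) (hh : Measurable h)
    (hf0 : ∀ x, 0 ≤ f x) (hg0 : ∀ x, 0 ≤ g x) (hh0 : ∀ x, 0 ≤ h x)
    (hfb : BddAbove (Set.range f)) (hgb : BddAbove (Set.range g))
    (H : ∀ x y, f x ^ a * g y ^ b ≤ h (a * x + b * y)) :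
    (∫⁻ x, ENNReal.ofReal (f x)) ^ a * (∫⁻ x, ENNReal.ofReal (g x)) ^ b
      ≤ ∫⁻ x, ENNReal.ofReal (h x) := by
  have sup_pos : ∀ u : ℝ → ℝ, (∀ x, 0 ≤ u x) → BddAbove (Set.range u) →
      (∫⁻ x, ENNReal.ofReal (u x)) ≠ 0 → 0 < ⨆ x, u x := by
    intro u hu0 hub hne
    by_contra hle
    refine hne ?_
    have : ∀ x, ENNReal.ofReal (u x) = 0 := fun x =>
      ENNReal.ofReal_of_nonpos ((le_ciSup hub x).trans (not_lt.1 hle))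
    simp [this]
  rcases eq_or_ne (∫⁻ x, ENNReal.ofReal (f x)) 0 with hfz | hfz
  · simp [hfz, ENNReal.zero_rpow_of_pos ha]
  rcases eq_or_ne (∫⁻ x, ENNReal.ofReal (g x)) 0 with hgz | hgz
  · simp [hgz, ENNReal.zero_rpow_of_pos hb]
  have hM := sup_pos f hf0 hfb hfz
  have hN := sup_pos g hg0 hgb hgz
  set M := ⨆ x, f x
  set N := ⨆ x, g x
  have lub : ∀ u : ℝ → ℝ, BddAbove (Set.range u) → 0 < ⨆ x, u x →
      IsLUB (Set.range fun x => (⨆ x, u x)⁻¹ * u x) 1 := by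
    intro u hub hpos
    have h1 := (isLUB_ciSup hub).mul_left (inv_nonneg.2 hpos.le)
    rw [inv_mul_cancel₀ hpos.ne', ← Set.range_comp] at h1
    exact h1
  have hMN : 0 < M ^ a * N ^ b := by positivity
  have key := mul_lintegral_add_mul_lintegral_le (f := fun x => M⁻¹ * f x)
    (g := fun x => N⁻¹ * g x) (h := fun x => (M ^ a * N ^ b)⁻¹ * h x) ha hb hab
    (hf.const_mul _) (hg.const_mul _) (hh.const_mul _)
    (fun x => mul_nonneg (inv_nonneg.2 hM.le) (hf0 x))
    (fun x => mul_nonneg (inv_nonneg.2 hN.le) (hg0 x))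
    (fun x => mul_nonneg (inv_nonneg.2 hMN.le) (hh0 x)) (lub f hfb hM) (lub g hgb hN) ?_
  · have pull : ∀ (c : ℝ) (u : ℝ → ℝ), 0 < c → Measurable u →
        ∫⁻ x, ENNReal.ofReal (c⁻¹ * u x) = (ENNReal.ofReal c)⁻¹ * ∫⁻ x, ENNReal.ofReal (u x) := by
      intro c u hc hu
      rw [← lintegral_const_mul _ hu.ennreal_ofReal]
      simp_rw [ENNReal.ofReal_mul (inv_nonneg.2 hc.le), ENNReal.ofReal_inv_of_pos hc]
    rw [pull M f hM hf, pull N g hN hg, pull _ h hMN hh] at key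
    have amgm : ∀ x y : ENNReal, x ^ a * y ^ b ≤ ENNReal.ofReal a * x + ENNReal.ofReal b * y := by
      intro x y
      rcases eq_or_ne x ⊤ with rfl | hx
      · simp [ENNReal.mul_top, ha]
      rcases eq_or_ne y ⊤ with rfl | hy
      · simp [ENNReal.mul_top, hb]
      lift x to NNReal using hx
      lift y to NNReal using hy
      have := NNReal.geom_mean_le_arith_mean2_weighted a.toNNReal b.toNNReal x y
        (by rw [← Real.toNNReal_add ha.le hb.le, hab, Real.toNNReal_one])
      rw [Real.coe_toNNReal a ha.le, Real.coe_toNNReal b hb.le] at this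
      rw [← ENNReal.coe_rpow_of_nonneg _ ha.le, ← ENNReal.coe_rpow_of_nonneg _ hb.le]
      simpa [ENNReal.ofReal] using ENNReal.coe_le_coe.2 this
    have key2 := (amgm _ _).trans key
    rw [ENNReal.mul_rpow_of_nonneg _ _ ha.le, ENNReal.mul_rpow_of_nonneg _ _ hb.le,
      mul_mul_mul_comm, ENNReal.inv_rpow, ENNReal.inv_rpow, ENNReal.ofReal_rpow_of_pos hM,
      ENNReal.ofReal_rpow_of_pos hN, ← ENNReal.mul_inv (by simp) (by simp),
      ← ENNReal.ofReal_mul (by positivity)] at key2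
    exact (ENNReal.mul_le_mul_iff_right (by simp) (by simpa using hMN)).1 key2
  · intro x y
    rw [Real.mul_rpow (inv_nonneg.2 hM.le) (hf0 x), Real.mul_rpow (inv_nonneg.2 hN.le) (hg0 y),
      mul_mul_mul_comm, Real.inv_rpow hM.le, Real.inv_rpow hN.le, ← mul_inv]
    exact mul_le_mul_of_nonneg_left (H x y) (inv_nonneg.2 hMN.le)

/-! ### Volumes of Orlicz balls -/

theorem IsYoungFunction.continuous {V : ℝ → ℝ} (hV : IsYoungFunction V) : Continuous V := by
  rw [← continuousOn_univ]
  exact hV.convexOn.continuousOn isOpen_univ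

theorem IsYoungFunction.map_combination_le {V : ℝ → ℝ} (hV : IsYoungFunction V) {a b : ℝ}
    (ha : 0 ≤ a) (hb : 0 ≤ b) (hab : a + b = 1) (x y : ℝ) :
    V (a * x + b * y) ≤ a * V x + b * V y := by
  simpa using hV.convexOn.2 (Set.mem_univ x) (Set.mem_univ y) ha hb hab

theorem lintegral_exp_neg_eq_one {V : ℝ → ℝ}
    (hμ : IsProbabilityMeasure (gibbsMeasure V)) :
    ∫⁻ x, ENNReal.ofReal (Real.exp (-V x)) = 1 := by
  have := hμ.measure_univ
  rwa [gibbsMeasure, withDensity_apply _ MeasurableSet.univ, Measure.restrict_univ] at this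

theorem orliczBall_mono (V : ℝ → ℝ) (n : ℕ) : Monotone (orliczBall V n) :=
  fun _ _ h _ hx => le_trans (show _ ≤ _ from hx) h

theorem measurableSet_orliczBall {V : ℝ → ℝ} (hV : Measurable V) (n : ℕ) (E : ℝ) :
    MeasurableSet (orliczBall V n E) :=
  measurableSet_le (by fun_prop) measurable_const

theorem volume_orliczBall_zero (V : ℝ → ℝ) (E : ℝ) :
    volume (orliczBall V 0 E) = if 0 ≤ E then 1 else 0 := by
  split_ifs with h <;> simp [orliczBall, h, volume_pi]

/-- Integrating over the fibres of the first coordinate. -/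
theorem lintegral_pi_succ {n : ℕ} {f : (Fin (n + 1) → ℝ) → ENNReal} (hf : Measurable f) :
    ∫⁻ x, f x = ∫⁻ x : ℝ, ∫⁻ y : Fin n → ℝ, f (Fin.cons x y) := by
  have hmp := (volume_preserving_piFinSuccAbove (fun _ : Fin (n + 1) => ℝ) 0).symm
  rw [← hmp.lintegral_comp hf, Measure.volume_eq_prod,
    lintegral_prod (fun z => f ((MeasurableEquiv.piFinSuccAbove (fun _ => ℝ) 0).symm z))
      (hf.comp hmp.measurable).aemeasurable]
  simp only [MeasurableEquiv.piFinSuccAbove_symm_apply, Fin.insertNthEquiv_zero]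
  rfl

theorem volume_orliczBall_succ {V : ℝ → ℝ} (hV : Measurable V) (n : ℕ) (E : ℝ) :
    volume (orliczBall V (n + 1) E) = ∫⁻ x, volume (orliczBall V n (E - V x)) := by
  rw [← lintegral_indicator_one (measurableSet_orliczBall hV _ _),
    lintegral_pi_succ (measurable_one.indicator (measurableSet_orliczBall hV _ _))]
  refine lintegral_congr fun x => ?_
  rw [← lintegral_indicator_one (measurableSet_orliczBall hV _ _)]
  refine lintegral_congr fun y => ?_
  have : Fin.cons x y ∈ orliczBall V (n + 1) E ↔ y ∈ orliczBall V n (E - V x) := by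
    simp only [orliczBall, Set.mem_ofPred_eq, Fin.sum_univ_succ, Fin.cons_zero, Fin.cons_succ]
    exact le_sub_iff_add_le'.symm
  by_cases hy : y ∈ orliczBall V n (E - V x)
  · rw [Set.indicator_of_mem hy, Set.indicator_of_mem (this.2 hy)]
    rfl
  · rw [Set.indicator_of_notMem hy, Set.indicator_of_notMem (mt this.1 hy)]

theorem volume_orliczBall_le_exp {V : ℝ → ℝ} (hV : IsYoungFunction V)
    (hμ : IsProbabilityMeasure (gibbsMeasure V)) (n : ℕ) (E : ℝ) :
    volume (orliczBall V n E) ≤ ENNReal.ofReal (Real.exp E) := by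
  induction n generalizing E with
  | zero =>
    rw [volume_orliczBall_zero]
    split_ifs with h
    · simpa using h
    · simp
  | succ n ih =>
    rw [volume_orliczBall_succ hV.continuous.measurable]
    calc ∫⁻ x, volume (orliczBall V n (E - V x))
        ≤ ∫⁻ x, ENNReal.ofReal (Real.exp E) * ENNReal.ofReal (Real.exp (-V x)) := by
          refine lintegral_mono fun x => (ih _).trans_eq ?_
          rw [← ENNReal.ofReal_mul (Real.exp_pos _).le, ← Real.exp_add, sub_eq_add_neg]
      _ = ENNReal.ofReal (Real.exp E) := by
          have := hV.continuous
          rw [lintegral_const_mul _ (by fun_prop), lintegral_exp_neg_eq_one hμ, mul_one]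

/-- The volume of an Orlicz ball is a log-concave function of the energy. The induction step
applies Prékopa–Leindler to the fibre volumes `x ↦ Vol_n (B_{E - V x})`; convexity of `V` is what
makes the interpolated fibre large enough. -/
theorem volume_orliczBall_logConcave {V : ℝ → ℝ} (hV : IsYoungFunction V)
    (hμ : IsProbabilityMeasure (gibbsMeasure V)) (n : ℕ) {a b : ℝ} (ha : 0 < a) (hb : 0 < b)
    (hab : a + b = 1) (E₁ E₂ : ℝ) :
    volume (orliczBall V n E₁) ^ a * volume (orliczBall V n E₂) ^ b
      ≤ volume (orliczBall V n (a * E₁ + b * E₂)) := by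
  have hfin : ∀ k E, volume (orliczBall V k E) ≠ ⊤ := fun k E =>
    ((volume_orliczBall_le_exp hV hμ k E).trans_lt ENNReal.ofReal_lt_top).ne
  have hVm := hV.continuous.measurable
  induction n generalizing E₁ E₂ with
  | zero =>
    simp only [volume_orliczBall_zero]
    by_cases h₁ : 0 ≤ E₁
    · by_cases h₂ : 0 ≤ E₂
      · have : 0 ≤ a * E₁ + b * E₂ := by positivity
        simp [h₁, h₂, this]
      · simp [h₂, ENNReal.zero_rpow_of_pos hb]
    · simp [h₁, ENNReal.zero_rpow_of_pos ha]
  | succ n ih =>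
    have hmeas : Measurable fun E => (volume (orliczBall V n E)).toReal :=
      (Monotone.measurable fun s t hst => measure_mono (orliczBall_mono V n hst)).ennreal_toReal
    have hmono : ∀ s t : ℝ, s ≤ t →
        (volume (orliczBall V n s)).toReal ≤ (volume (orliczBall V n t)).toReal := fun s t hst =>
      ENNReal.toReal_mono (hfin _ _) (measure_mono (orliczBall_mono V n hst))
    have hbdd : ∀ E : ℝ,
        BddAbove (Set.range fun x => (volume (orliczBall V n (E - V x))).toReal) := by
      rintro E
      refine ⟨(volume (orliczBall V n E)).toReal, ?_⟩
      rintro _ ⟨x, rfl⟩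
      exact hmono _ _ (by linarith [hV.nonneg x])
    have key := lintegral_rpow_mul_lintegral_rpow_le
      (f := fun x => (volume (orliczBall V n (E₁ - V x))).toReal)
      (g := fun x => (volume (orliczBall V n (E₂ - V x))).toReal)
      (h := fun x => (volume (orliczBall V n (a * E₁ + b * E₂ - V x))).toReal) ha hb hab
      (hmeas.comp (by fun_prop)) (hmeas.comp (by fun_prop)) (hmeas.comp (by fun_prop))
      (fun _ => ENNReal.toReal_nonneg) (fun _ => ENNReal.toReal_nonneg)
      (fun _ => ENNReal.toReal_nonneg) (hbdd _) (hbdd _) ?_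
    · simp_rw [ENNReal.ofReal_toReal (hfin _ _)] at key
      simpa only [volume_orliczBall_succ hVm] using key
    · intro x y
      rw [ENNReal.toReal_rpow, ENNReal.toReal_rpow, ← ENNReal.toReal_mul]
      refine (ENNReal.toReal_mono (hfin _ _) (ih _ _)).trans (hmono _ _ ?_)
      linarith [hV.map_combination_le ha.le hb.le hab x y]

/-- The function `E ↦ e^{-E} Vol_n (B_E)`, which is the density of `∑ i, V (X i) + T` for
independent `X i` with law `e^{-V}` and a standard exponential variable `T`. -/
noncomputable def volumeDensity (V : ℝ → ℝ) (n : ℕ) (E : ℝ) : ENNReal :=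
  ENNReal.ofReal (Real.exp (-E)) * volume (orliczBall V n E)

/-- Quasi-concavity: the factor `e^{-E}` is log-affine, so it preserves log-concavity. -/
theorem min_volumeDensity_le {V : ℝ → ℝ} (hV : IsYoungFunction V)
    (hμ : IsProbabilityMeasure (gibbsMeasure V)) (n : ℕ) {p E q : ℝ} (hp : p ≤ E) (hq : E ≤ q) :
    min (volumeDensity V n p) (volumeDensity V n q) ≤ volumeDensity V n E := by
  rcases hp.eq_or_lt with rfl | hp
  · exact min_le_left _ _
  rcases hq.eq_or_lt with rfl | hq
  · exact min_le_right _ _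
  obtain ⟨a, b, ha, hb, hab, hE⟩ : E ∈ openSegment ℝ p q := by
    rw [openSegment_eq_Ioo (hp.trans hq)]; exact ⟨hp, hq⟩
  simp only [smul_eq_mul] at hE
  have hexp : ENNReal.ofReal (Real.exp (-p)) ^ a * ENNReal.ofReal (Real.exp (-q)) ^ b
      = ENNReal.ofReal (Real.exp (-E)) := by
    rw [ENNReal.ofReal_rpow_of_pos (Real.exp_pos _), ENNReal.ofReal_rpow_of_pos (Real.exp_pos _),
      ← ENNReal.ofReal_mul (by positivity), ← Real.exp_mul, ← Real.exp_mul, ← Real.exp_add, ← hE]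
    ring_nf
  set m := min (volumeDensity V n p) (volumeDensity V n q)
  calc m = m ^ a * m ^ b := by
        rw [← ENNReal.rpow_add_of_nonneg _ _ ha.le hb.le, hab, ENNReal.rpow_one]
    _ ≤ volumeDensity V n p ^ a * volumeDensity V n q ^ b :=
        mul_le_mul' (ENNReal.rpow_le_rpow (min_le_left _ _) ha.le)
          (ENNReal.rpow_le_rpow (min_le_right _ _) hb.le)
    _ = ENNReal.ofReal (Real.exp (-E))
          * (volume (orliczBall V n p) ^ a * volume (orliczBall V n q) ^ b) := by
        rw [volumeDensity, volumeDensity, ENNReal.mul_rpow_of_nonneg _ _ ha.le,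
          ENNReal.mul_rpow_of_nonneg _ _ hb.le, mul_mul_mul_comm, hexp]
    _ ≤ volumeDensity V n E := by
        rw [volumeDensity, ← hE]
        gcongr
        exact volume_orliczBall_logConcave hV hμ n ha hb hab p q

/-- Between two flanking intervals a quasi-concave function is at least one of the two averages. -/
theorem le_volumeDensity_of_le_setLIntegral {V : ℝ → ℝ} (hV : IsYoungFunction V)
    (hμ : IsProbabilityMeasure (gibbsMeasure V)) (n : ℕ) {p p' E q' q : ℝ} {c : ENNReal}
    (hp : p < p') (hpE : p' ≤ E) (hEq : E ≤ q') (hq : q' < q)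
    (hleft : c * ENNReal.ofReal (p' - p) ≤ ∫⁻ x in Set.Icc p p', volumeDensity V n x)
    (hright : c * ENNReal.ofReal (q - q') ≤ ∫⁻ x in Set.Icc q' q, volumeDensity V n x) :
    c ≤ volumeDensity V n E := by
  have average : ∀ r s : ℝ, r < s →
      c * ENNReal.ofReal (s - r) ≤ ∫⁻ x in Set.Icc r s, volumeDensity V n x →
      (∀ x ∈ Set.Icc r s, volumeDensity V n x ≤ volumeDensity V n E) →
      c ≤ volumeDensity V n E := by
    intro r s hrs hc hle
    have h1 : ∫⁻ x in Set.Icc r s, volumeDensity V n x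
        ≤ volumeDensity V n E * ENNReal.ofReal (s - r) := by
      rw [← Real.volume_Icc, ← setLIntegral_const]
      exact setLIntegral_mono measurable_const hle
    exact (ENNReal.mul_le_mul_iff_left (by simpa using hrs) (by simp)).1 (hc.trans h1)
  by_cases hl : ∀ x ∈ Set.Icc p p', volumeDensity V n x ≤ volumeDensity V n E
  · exact average p p' hp hleft hl
  · push Not at hl
    obtain ⟨x, hx, hxE⟩ := hl
    refine average q' q hq hright fun y hy => ?_
    have := min_volumeDensity_le hV hμ n (hx.2.trans hpE) (hEq.trans hy.1)
    exact (min_le_iff.1 this).resolve_left (not_le.2 hxE)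

/-! ### Product Gibbs measures -/

theorem lintegral_prod_eq_prod_lintegral {n : ℕ} {f : Fin n → ℝ → ENNReal}
    (hf : ∀ i, Measurable (f i)) :
    ∫⁻ x : Fin n → ℝ, ∏ i, f i (x i) = ∏ i, ∫⁻ x, f i x := by
  induction n with
  | zero => simp [volume_pi]
  | succ n ih =>
    rw [lintegral_pi_succ (by fun_prop), Fin.prod_univ_succ, ← ih fun i => hf i.succ,
      ← lintegral_mul_const _ (hf 0)]
    refine lintegral_congr fun x => ?_
    simp only [Fin.prod_univ_succ, Fin.cons_zero, Fin.cons_succ]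
    exact lintegral_const_mul _ (by fun_prop)

theorem pi_gibbsMeasure {V : ℝ → ℝ} (hV : Measurable V) (n : ℕ)
    [IsProbabilityMeasure (gibbsMeasure V)] :
    Measure.pi (fun _ : Fin n => gibbsMeasure V)
      = volume.withDensity fun x => ENNReal.ofReal (Real.exp (-∑ i, V (x i))) := by
  refine (Measure.pi_eq fun s hs => ?_)
  rw [withDensity_apply _ (MeasurableSet.univ_pi hs),
    ← lintegral_indicator (MeasurableSet.univ_pi hs)]
  simp only [gibbsMeasure]
  simp_rw [withDensity_apply _ (hs _), ← lintegral_indicator (hs _)]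
  rw [← lintegral_prod_eq_prod_lintegral fun i =>
    (show Measurable fun x => ENNReal.ofReal (Real.exp (-V x)) by fun_prop).indicator (hs i)]
  refine lintegral_congr fun x => ?_
  classical
  by_cases hx : x ∈ Set.univ.pi s
  · rw [Set.indicator_of_mem hx, ← Finset.sum_neg_distrib, Real.exp_sum,
      ENNReal.ofReal_prod_of_nonneg fun i _ => (Real.exp_pos _).le]
    refine Finset.prod_congr rfl fun i _ => ?_
    rw [Set.indicator_of_mem (hx i trivial)]
  · rw [Set.indicator_of_notMem hx]
    simp only [Set.mem_univ_pi, not_forall] at hx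
    obtain ⟨i, hi⟩ := hx
    exact (Finset.prod_eq_zero (Finset.mem_univ i) (Set.indicator_of_notMem hi _)).symm

theorem ofReal_one_sub_exp_mul_le_setLIntegral {p q s u : ℝ} (hu : 0 ≤ u)
    (hs : s ∈ Set.Icc p (q - u)) :
    ENNReal.ofReal (1 - Real.exp (-u)) * ENNReal.ofReal (Real.exp (-s))
      ≤ ∫⁻ E in Set.Icc p q, ENNReal.ofReal (Real.exp (-E)) * (Set.Ici s).indicator 1 E := by
  have hint : ∫ E in s..s + u, Real.exp (-E) = (1 - Real.exp (-u)) * Real.exp (-s) := by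
    rw [intervalIntegral.integral_comp_neg, integral_exp, neg_add, Real.exp_add]
    ring
  calc ENNReal.ofReal (1 - Real.exp (-u)) * ENNReal.ofReal (Real.exp (-s))
      = ENNReal.ofReal (∫ E in Set.Ioc s (s + u), Real.exp (-E)) := by
        rw [← intervalIntegral.integral_of_le (by linarith), hint, ENNReal.ofReal_mul]
        simpa using hu
    _ = ∫⁻ E in Set.Ioc s (s + u), ENNReal.ofReal (Real.exp (-E)) := by
        refine ofReal_integral_eq_lintegral_ofReal ?_ (.of_forall fun E => (Real.exp_pos _).le)
        exact (Continuous.integrableOn_Icc (by fun_prop)).mono_set Set.Ioc_subset_Icc_self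
    _ = ∫⁻ E in Set.Ioc s (s + u),
          ENNReal.ofReal (Real.exp (-E)) * (Set.Ici s).indicator 1 E := by
        refine setLIntegral_congr_fun measurableSet_Ioc fun E hE => ?_
        simp [Set.indicator_of_mem (show E ∈ Set.Ici s from hE.1.le)]
    _ ≤ _ := lintegral_mono_set (Set.Ioc_subset_Icc_self.trans
        (Set.Icc_subset_Icc hs.1 (by linarith [hs.2])))

theorem lintegral_exp_neg_mul_indicator_Ici {V : ℝ → ℝ} (hV : Measurable V) (n : ℕ) (E : ℝ) :
    ∫⁻ x : Fin n → ℝ, ENNReal.ofReal (Real.exp (-E)) * (Set.Ici (∑ i, V (x i))).indicator 1 E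
      = volumeDensity V n E := by
  have hT := measurableSet_orliczBall hV n E
  have hi : ∀ x : Fin n → ℝ, (Set.Ici (∑ i, V (x i))).indicator (1 : ℝ → ENNReal) E
      = (orliczBall V n E).indicator 1 x := fun x => rfl
  simp_rw [hi]
  rw [volumeDensity, lintegral_const_mul _ (measurable_one.indicator hT),
    lintegral_indicator_one hT]

/-- The integral of `e^{-E} Vol_n (B_E)` over an energy window dominates the probability that
`∑ i, V (X i)` lies in the window shortened by `u` at its right end, up to `1 - e^{-u}`, the
probability that a standard exponential variable is at most `u`. -/
theorem pi_gibbsMeasure_le_setLIntegral {V : ℝ → ℝ} (hV : Measurable V) (n : ℕ)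
    [IsProbabilityMeasure (gibbsMeasure V)] (p q : ℝ) {u : ℝ} (hu : 0 ≤ u) :
    ENNReal.ofReal (1 - Real.exp (-u))
        * Measure.pi (fun _ : Fin n => gibbsMeasure V) {x | ∑ i, V (x i) ∈ Set.Icc p (q - u)}
      ≤ ∫⁻ E in Set.Icc p q, volumeDensity V n E := by
  have hS : Measurable fun x : Fin n → ℝ => ∑ i, V (x i) := by fun_prop
  have hA : MeasurableSet {x : Fin n → ℝ | ∑ i, V (x i) ∈ Set.Icc p (q - u)} :=
    hS measurableSet_Icc
  set A := {x : Fin n → ℝ | ∑ i, V (x i) ∈ Set.Icc p (q - u)}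
  let F : (Fin n → ℝ) → ℝ → ENNReal := fun x E =>
    ENNReal.ofReal (Real.exp (-E)) * (Set.Ici (∑ i, V (x i))).indicator 1 E
  have hF : Measurable (Function.uncurry F) := by
    have hT : MeasurableSet {z : (Fin n → ℝ) × ℝ | ∑ i, V (z.1 i) ≤ z.2} :=
      measurableSet_le (by fun_prop) measurable_snd
    have hT1 : Measurable fun z : (Fin n → ℝ) × ℝ =>
        (Set.Ici (∑ i, V (z.1 i))).indicator (1 : ℝ → ENNReal) z.2 :=
      measurable_one.indicator hT
    exact Measurable.mul (by fun_prop) hT1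
  have hleft : ENNReal.ofReal (1 - Real.exp (-u)) * Measure.pi (fun _ : Fin n => gibbsMeasure V) A
      = ∫⁻ x in A, ENNReal.ofReal (1 - Real.exp (-u))
          * ENNReal.ofReal (Real.exp (-∑ i, V (x i))) := by
    rw [pi_gibbsMeasure hV, withDensity_apply _ hA, lintegral_const_mul _ (by fun_prop)]
  have hle : ∫⁻ x in A, ENNReal.ofReal (1 - Real.exp (-u))
      * ENNReal.ofReal (Real.exp (-∑ i, V (x i))) ≤ ∫⁻ x in A, ∫⁻ E in Set.Icc p q, F x E :=
    setLIntegral_mono' hA fun x hx => ofReal_one_sub_exp_mul_le_setLIntegral hu hx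
  have hswap : ∫⁻ x, ∫⁻ E in Set.Icc p q, F x E = ∫⁻ E in Set.Icc p q, ∫⁻ x, F x E :=
    lintegral_lintegral_swap hF.aemeasurable
  rw [hleft]
  refine (hle.trans (setLIntegral_le_lintegral _ _)).trans (hswap.trans ?_).le
  exact lintegral_congr (lintegral_exp_neg_mul_indicator_Ici hV n)

/-! ### The variance of a convex potential -/

theorem Real.two_add_sq_le_exp_add_exp_neg (x : ℝ) : 2 + x ^ 2 ≤ Real.exp x + Real.exp (-x) := by
  -- `cosh x - 1 = 2 sinh² (x / 2)`, reduced to `0 ≤ x` by evenness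
  wlog hx : 0 ≤ x generalizing x
  · have := this (-x) (by linarith)
    rw [neg_neg, neg_sq] at this
    linarith
  have h1 : x / 2 ≤ Real.sinh (x / 2) := Real.self_le_sinh_iff.2 (by linarith)
  rw [Real.sinh_eq] at h1
  have h2 : Real.exp x = Real.exp (x / 2) ^ 2 := by rw [← Real.exp_nat_mul]; congr 1; push_cast; ring
  have h3 : Real.exp (-x) = Real.exp (-(x / 2)) ^ 2 := by
    rw [← Real.exp_nat_mul]; congr 1; push_cast; ring
  have h4 : Real.exp (x / 2) * Real.exp (-(x / 2)) = 1 := by rw [← Real.exp_add]; simp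
  rw [h2, h3]
  nlinarith

/-- After centring, both factors are at least `1` by Jensen and their sum is at least
`2 + t² Var X`; then `A B ≥ A + B - 1`. -/
theorem one_add_sq_mul_variance_le_mgf_mul_mgf {Ω : Type*} [MeasurableSpace Ω] {P : Measure Ω}
    [IsProbabilityMeasure P] {X : Ω → ℝ} (hX : MemLp X 2 P) {t : ℝ}
    (ht : Integrable (fun ω => Real.exp (t * X ω)) P)
    (ht' : Integrable (fun ω => Real.exp (-t * X ω)) P) :
    1 + t ^ 2 * variance X P ≤ mgf X P t * mgf X P (-t) := by
  set m := ∫ ω, X ω ∂P with hm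
  have hX1 : Integrable X P := hX.integrable (by norm_num)
  have hc : Integrable (fun ω => X ω - m) P := hX1.sub (integrable_const m)
  have hc0 : ∫ ω, (X ω - m) ∂P = 0 := by
    rw [integral_sub hX1 (integrable_const m)]; simp [hm]
  have split : ∀ s : ℝ, (fun ω => Real.exp (s * (X ω - m)))
      = fun ω => Real.exp (-(s * m)) * Real.exp (s * X ω) := fun s => by
    funext ω; rw [← Real.exp_add]; ring_nf
  have centred_int : ∀ s : ℝ, Integrable (fun ω => Real.exp (s * X ω)) P →
      Integrable (fun ω => Real.exp (s * (X ω - m))) P := fun s hs => by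
    rw [split]; exact hs.const_mul _
  have one_le : ∀ s : ℝ, Integrable (fun ω => Real.exp (s * X ω)) P →
      1 ≤ ∫ ω, Real.exp (s * (X ω - m)) ∂P := by
    intro s hs
    calc (1 : ℝ) = ∫ ω, (1 + s * (X ω - m)) ∂P := by
          rw [integral_add (integrable_const 1) (hc.const_mul s), integral_const_mul, hc0]
          simp
      _ ≤ _ := integral_mono ((integrable_const 1).add (hc.const_mul s)) (centred_int s hs)
          fun ω => by simpa [add_comm] using Real.add_one_le_exp (s * (X ω - m))
  have hsq : Integrable (fun ω => (X ω - m) ^ 2) P :=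
    (hX.sub (memLp_const m)).integrable_sq
  have sum_le : 2 + t ^ 2 * variance X P
      ≤ ∫ ω, Real.exp (t * (X ω - m)) ∂P + ∫ ω, Real.exp (-t * (X ω - m)) ∂P := by
    rw [variance_eq_integral hX.aemeasurable, ← integral_add (centred_int t ht)
      (centred_int (-t) ht'), ← integral_const_mul]
    calc (2 : ℝ) + ∫ ω, t ^ 2 * (X ω - m) ^ 2 ∂P
        = ∫ ω, (2 + t ^ 2 * (X ω - m) ^ 2) ∂P := by
          rw [integral_add (integrable_const 2) (hsq.const_mul _)]; simp
      _ ≤ _ := integral_mono ((integrable_const 2).add (hsq.const_mul _))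
          ((centred_int t ht).add (centred_int (-t) ht')) fun ω => by
            have := Real.two_add_sq_le_exp_add_exp_neg (t * (X ω - m))
            simp only [neg_mul, Pi.add_apply]
            linarith [mul_pow t (X ω - m) 2]
  have hprod : mgf X P t * mgf X P (-t)
      = (∫ ω, Real.exp (t * (X ω - m)) ∂P) * ∫ ω, Real.exp (-t * (X ω - m)) ∂P := by
    rw [split, split, integral_const_mul, integral_const_mul, mul_mul_mul_comm, ← Real.exp_add]
    simp [mgf]
  rw [hprod]
  nlinarith [one_le t ht, one_le (-t) ht']

theorem lintegral_exp_neg_mul_dilation {V : ℝ → ℝ} (hV : Measurable V) {α : ℝ} (hα : 0 < α) :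
    ∫⁻ x, ENNReal.ofReal (Real.exp (-(α * V (α⁻¹ * x))))
      = ENNReal.ofReal α * ∫⁻ x, ENNReal.ofReal (Real.exp ((1 - α) * V x)) ∂(gibbsMeasure V) := by
  have h1 : ∫⁻ x, ENNReal.ofReal (Real.exp (-(α * V (α⁻¹ * x))))
      = ∫⁻ y, ENNReal.ofReal (Real.exp (-(α * V y))) ∂(Measure.map (α⁻¹ * ·) volume) := by
    rw [lintegral_map (by fun_prop) (by fun_prop)]
  rw [h1, Real.map_volume_mul_left (inv_ne_zero hα.ne'), lintegral_smul_measure, inv_inv,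
    abs_of_pos hα, gibbsMeasure, lintegral_withDensity_eq_lintegral_mul _ (by fun_prop)
    (by fun_prop), smul_eq_mul]
  congr 1
  refine lintegral_congr fun x => ?_
  rw [Pi.mul_apply, ← ENNReal.ofReal_mul (Real.exp_pos _).le, ← Real.exp_add]
  ring_nf

/-- `α ↦ α ∫ e^{-α V}` is log-concave, here at the points `1 - t`, `1`, `1 + t`: it is the marginal
`∫ e^{-α V (x / α)} dx`, and the perspective `(α, x) ↦ α V (x / α)` is convex. -/
theorem lintegral_exp_mul_lintegral_exp_neg_le {V : ℝ → ℝ} (hV : IsYoungFunction V)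
    (hμ : IsProbabilityMeasure (gibbsMeasure V)) {t : ℝ} (ht : t ∈ Set.Ioo (0 : ℝ) 1) :
    ENNReal.ofReal (1 - t ^ 2) * ((∫⁻ x, ENNReal.ofReal (Real.exp (t * V x)) ∂(gibbsMeasure V))
      * ∫⁻ x, ENNReal.ofReal (Real.exp (-t * V x)) ∂(gibbsMeasure V)) ≤ 1 := by
  have hVm := hV.continuous.measurable
  have h1 : 0 < 1 - t := by linarith [ht.2]
  have h2 : 0 < 1 + t := by linarith [ht.1]
  have bdd : ∀ α : ℝ, 0 < α →
      BddAbove (Set.range fun x => Real.exp (-(α * V (α⁻¹ * x)))) := by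
    rintro α hα
    refine ⟨1, ?_⟩
    rintro _ ⟨x, rfl⟩
    have := mul_nonneg hα.le (hV.nonneg (α⁻¹ * x))
    simpa using this
  have key := lintegral_rpow_mul_lintegral_rpow_le (a := 1 / 2) (b := 1 / 2)
    (f := fun x => Real.exp (-((1 - t) * V ((1 - t)⁻¹ * x))))
    (g := fun x => Real.exp (-((1 + t) * V ((1 + t)⁻¹ * x))))
    (h := fun x => Real.exp (-V x)) (by norm_num) (by norm_num) (by norm_num)
    (by fun_prop) (by fun_prop) (by fun_prop) (fun _ => (Real.exp_pos _).le)
    (fun _ => (Real.exp_pos _).le) (fun _ => (Real.exp_pos _).le) (bdd _ h1) (bdd _ h2) ?_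
  · rw [lintegral_exp_neg_mul_dilation hVm h1, lintegral_exp_neg_mul_dilation hVm h2,
      lintegral_exp_neg_eq_one hμ, ← ENNReal.mul_rpow_of_nonneg _ _ (by norm_num),
      ← ENNReal.one_rpow (1 / 2), ENNReal.rpow_le_rpow_iff (by norm_num), mul_mul_mul_comm,
      ← ENNReal.ofReal_mul h1.le, show (1 - t) * (1 + t) = 1 - t ^ 2 by ring,
      sub_sub_cancel, sub_add_cancel_left] at key
    exact key
  · intro x y
    rw [← Real.exp_mul, ← Real.exp_mul, ← Real.exp_add, Real.exp_le_exp]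
    have hconv := hV.map_combination_le (a := (1 - t) / 2) (b := (1 + t) / 2) (by positivity)
      (by positivity) (by ring) ((1 - t)⁻¹ * x) ((1 + t)⁻¹ * y)
    have harg : (1 - t) / 2 * ((1 - t)⁻¹ * x) + (1 + t) / 2 * ((1 + t)⁻¹ * y)
        = 1 / 2 * x + 1 / 2 * y := by field_simp
    rw [harg] at hconv
    linarith

/-- The one-dimensional varentropy bound: the log-concavity of `α ↦ α ∫ e^{-α V}` gives
`(1 - t²) (1 + t² σ²) ≤ 1`, and `t → 0`. Integrability of `e^{t V}` is part of what
`lintegral_exp_mul_lintegral_exp_neg_le` provides. -/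
theorem variance_gibbsMeasure_le_one {V : ℝ → ℝ} (hV : IsYoungFunction V)
    (hμ : IsProbabilityMeasure (gibbsMeasure V)) : variance V (gibbsMeasure V) ≤ 1 := by
  have hVm := hV.continuous.measurable
  set v := variance V (gibbsMeasure V)
  have bound : ∀ t ∈ Set.Ioo (0 : ℝ) 1, v * (1 - t ^ 2) ≤ 1 := by
    intro t ht
    have ht2 : 0 < 1 - t ^ 2 := by nlinarith [ht.1, ht.2]
    have key := lintegral_exp_mul_lintegral_exp_neg_le hV hμ ht
    have hneg : Integrable (fun x => Real.exp (-t * V x)) (gibbsMeasure V) := by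
      refine (integrable_const (1 : ℝ)).mono' (by fun_prop) (.of_forall fun x => ?_)
      rw [Real.norm_of_nonneg (Real.exp_pos _).le, Real.exp_le_one_iff]
      nlinarith [ht.1, hV.nonneg x]
    have hpos : Integrable (fun x => Real.exp (t * V x)) (gibbsMeasure V) := by
      refine ⟨by fun_prop, ?_⟩
      rw [hasFiniteIntegral_iff_ofReal (.of_forall fun x => (Real.exp_pos _).le), lt_top_iff_ne_top]
      intro htop
      have hne : ∫⁻ x, ENNReal.ofReal (Real.exp (-t * V x)) ∂(gibbsMeasure V) ≠ 0 := by
        rw [← ofReal_integral_eq_lintegral_ofReal hneg (.of_forall fun x => (Real.exp_pos _).le)]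
        have : 0 < mgf V (gibbsMeasure V) (-t) := mgf_pos hneg
        simpa [mgf] using this
      rw [htop, ENNReal.top_mul hne, ENNReal.mul_top (by simpa using ht2)] at key
      simp at key
    rw [← ofReal_integral_eq_lintegral_ofReal hneg (.of_forall fun x => (Real.exp_pos _).le),
      ← ofReal_integral_eq_lintegral_ofReal hpos (.of_forall fun x => (Real.exp_pos _).le),
      ← ENNReal.ofReal_mul (integral_nonneg fun x => (Real.exp_pos _).le),
      ← ENNReal.ofReal_mul ht2.le, ENNReal.ofReal_le_one] at key
    have hvar := one_add_sq_mul_variance_le_mgf_mul_mgf hV.memLp_two hpos hneg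
    have := (mul_le_mul_of_nonneg_left hvar ht2.le).trans key
    have hsq : 0 < t ^ 2 := by have := ht.1; positivity
    refine le_of_mul_le_mul_left ?_ hsq
    nlinarith
  have hlim : Filter.Tendsto (fun t : ℝ => v * (1 - t ^ 2)) (nhdsWithin 0 (Set.Ioi 0)) (nhds v) := by
    have : Filter.Tendsto (fun t : ℝ => v * (1 - t ^ 2)) (nhds 0) (nhds (v * (1 - 0 ^ 2))) :=
      Continuous.tendsto (by fun_prop) 0
    simpa using this.mono_left nhdsWithin_le_nhds
  refine le_of_tendsto hlim ?_
  filter_upwards [Ioo_mem_nhdsGT (zero_lt_one' ℝ)] with t ht using bound t ht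

theorem variance_gibbsMeasure_pos {V : ℝ → ℝ} (hV : IsYoungFunction V)
    (hμ : IsProbabilityMeasure (gibbsMeasure V)) : 0 < variance V (gibbsMeasure V) := by
  refine lt_of_le_of_ne (variance_nonneg _ _) fun h => ?_
  have hVc := hV.continuous
  have hae := ae_eq_integral_of_variance_eq_zero hV.memLp_two h.symm
  set m := ∫ x, V x ∂(gibbsMeasure V)
  have hac : volume ≪ gibbsMeasure V :=
    withDensity_absolutelyContinuous' (by fun_prop) (.of_forall fun x => by
      simpa using Real.exp_pos _)
  have hconst : V = fun _ => m :=
    Continuous.ae_eq_iff_eq volume hVc continuous_const |>.1 (hac.ae_le hae)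
  have h0 := (hV.eq_zero_iff 0).2 rfl
  have h1 : V 1 = V 0 := by rw [hconst]
  exact one_ne_zero ((hV.eq_zero_iff 1).1 (h1.trans h0))

/-! ### Averages over windows of width `√n` -/

theorem map_eq_pi_of_iIndepFun {Ω : Type*} [MeasurableSpace Ω] {P : Measure Ω}
    [IsProbabilityMeasure P] {μ : Measure ℝ} {X : ℕ → Ω → ℝ} (hm : ∀ i, Measurable (X i))
    (hX : ∀ i, HasLaw (X i) μ P) (hindep : iIndepFun X P) (n : ℕ) :
    P.map (fun ω (i : Fin n) => X i ω) = Measure.pi fun _ : Fin n => μ := by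
  have h := (iIndepFun_iff_map_fun_eq_pi_map (fun i : Fin n => (hm i).aemeasurable)).1
    (hindep.precomp Fin.val_injective)
  simpa only [(hX _).map_eq] using h

/-- The lower bound in the central limit theorem for `∑ i, V (x i)`, over windows of width `√n`. -/
theorem eventually_lt_pi_gibbsMeasure_window {V : ℝ → ℝ} (hV : IsYoungFunction V)
    [IsProbabilityMeasure (gibbsMeasure V)] (α γ : ℝ) {c : ENNReal}
    (hc : c < gaussianReal 0 (variance V (gibbsMeasure V)).toNNReal (Set.Ioo α γ)) :
    ∀ᶠ n : ℕ in Filter.atTop, c < Measure.pi (fun _ : Fin n => gibbsMeasure V)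
      {x | ∑ i, V (x i) ∈ Set.Icc ((∫ x, V x ∂(gibbsMeasure V)) * n + α * √n)
        ((∫ x, V x ∂(gibbsMeasure V)) * n + γ * √n)} := by
  have hVm := hV.continuous.measurable
  obtain ⟨Ω, _, P, X, hm, hX, hindep, _⟩ := exists_iid ℕ (gibbsMeasure V)
  have hident : ∀ i, IdentDistrib (fun ω => V (X i ω)) (fun ω => V (X 0 ω)) P P := fun i =>
    IdentDistrib.comp ⟨(hm i).aemeasurable, (hm 0).aemeasurable,
      (hX i).map_eq.trans (hX 0).map_eq.symm⟩ hVm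
  have hX0 : IdentDistrib (fun ω => V (X 0 ω)) V P (gibbsMeasure V) :=
    IdentDistrib.comp (f := X 0) (g := id) (u := V)
      ⟨(hm 0).aemeasurable, aemeasurable_id, by rw [(hX 0).map_eq, Measure.map_id]⟩ hVm
  have clt := tendstoInDistribution_inv_sqrt_mul_sum_sub (P := P)
    (X := fun i ω => V (X i ω)) (Y := id)
    (P' := gaussianReal 0 (variance (fun ω => V (X 0 ω)) P).toNNReal) HasLaw.id
    (hX0.memLp_iff.2 hV.memLp_two) (hindep.comp (fun _ => V) fun _ => hVm) hident
  have hlim := ProbabilityMeasure.le_liminf_measure_open_of_tendsto clt.tendsto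
    (isOpen_Ioo (a := α) (b := γ))
  simp only [ProbabilityMeasure.coe_mk, Measure.map_id, hX0.variance_eq, hX0.integral_eq] at hlim
  filter_upwards [Filter.eventually_lt_of_lt_liminf (hc.trans_le hlim),
    Filter.eventually_gt_atTop 0] with n hn hn0
  refine hn.trans_le ?_
  have hmS : ∀ p q : ℝ, MeasurableSet {x : Fin n → ℝ | ∑ i, V (x i) ∈ Set.Icc p q} := fun p q =>
    (show Measurable fun x : Fin n → ℝ => ∑ i, V (x i) by fun_prop) measurableSet_Icc
  rw [← map_eq_pi_of_iIndepFun hm hX hindep n, Measure.map_apply (by fun_prop) measurableSet_Ioo,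
    Measure.map_apply (by fun_prop) (hmS _ _)]
  refine measure_mono fun ω hω => ?_
  have hs : 0 < √(n : ℝ) := by positivity
  simp only [Set.mem_preimage, Set.mem_Ioo, inv_mul_eq_div, lt_div_iff₀ hs, div_lt_iff₀ hs,
    Finset.sum_range] at hω
  constructor <;> linarith [hω.1, hω.2]

theorem ofReal_mul_le_gaussianReal_Ioo {v : NNReal} (hv : v ≠ 0) {α γ ρ : ℝ} (hα : α ^ 2 ≤ ρ)
    (hγ : γ ^ 2 ≤ ρ) :
    ENNReal.ofReal ((√(2 * Real.pi * v))⁻¹ * Real.exp (-ρ / (2 * v)) * (γ - α))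
      ≤ gaussianReal 0 v (Set.Ioo α γ) := by
  rw [gaussianReal_apply 0 hv, ENNReal.ofReal_mul (by positivity), ← Real.volume_Ioo,
    ← setLIntegral_const]
  refine setLIntegral_mono (measurable_gaussianPDF 0 v) fun x hx => ?_
  refine ENNReal.ofReal_le_ofReal ?_
  rw [gaussianPDFReal]
  have : x ^ 2 ≤ ρ := by
    rcases le_total 0 x with h | h
    · nlinarith [hx.1, hx.2]
    · nlinarith [hx.1, hx.2]
  gcongr
  simpa using this

/-- Over a window of width `√n` whose rescaled endpoints have square less than `2 σ²`, the average
of `e^{-E} Vol_n (B_E)` eventually exceeds `e⁻¹ / √(2 π σ² n)`. -/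
theorem eventually_le_setLIntegral_volumeDensity {V : ℝ → ℝ} (hV : IsYoungFunction V)
    [hμ : IsProbabilityMeasure (gibbsMeasure V)] {α β ρ : ℝ} (hαβ : α < β) (hα : α ^ 2 ≤ ρ)
    (hβ : β ^ 2 ≤ ρ) (hρ : ρ < 2 * variance V (gibbsMeasure V)) :
    ∀ᶠ n : ℕ in Filter.atTop,
      ENNReal.ofReal ((√(2 * Real.pi * variance V (gibbsMeasure V)))⁻¹ * Real.exp (-1) * (β - α))
        ≤ ∫⁻ E in Set.Icc ((∫ x, V x ∂(gibbsMeasure V)) * n + α * √n)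
            ((∫ x, V x ∂(gibbsMeasure V)) * n + β * √n), volumeDensity V n E := by
  have hv := variance_gibbsMeasure_pos hV hμ
  set v := variance V (gibbsMeasure V)
  set m := ∫ x, V x ∂(gibbsMeasure V)
  set K := (√(2 * Real.pi * v))⁻¹
  have hK : 0 < K := by positivity
  have hexp : Real.exp (-1) < Real.exp (-ρ / (2 * v)) := by
    rw [Real.exp_lt_exp, lt_div_iff₀ (by positivity)]
    linarith
  -- the sub-window `(α, γ)` carries enough Gaussian mass and leaves room for the exponential tail
  obtain ⟨κ, hκ0, hκ1⟩ := exists_between ((div_lt_one (Real.exp_pos _)).2 hexp)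
  have hκpos : 0 < κ := lt_trans (by positivity) hκ0
  rw [div_lt_iff₀ (Real.exp_pos _)] at hκ0
  have hβα : 0 < β - α := sub_pos.2 hαβ
  set γ := α + κ * (β - α) with hγdef
  have hγα : α < γ := by have := mul_pos hκpos hβα; linarith
  have hγβ : γ < β := by nlinarith
  have hγ : γ ^ 2 ≤ ρ := by
    rcases le_total 0 γ with h | h <;> nlinarith
  have hmass := ofReal_mul_le_gaussianReal_Ioo (v := v.toNNReal) (by simpa using hv) hα hγ
  rw [Real.coe_toNNReal v hv.le] at hmass
  have hT : K * Real.exp (-1) * (β - α) < K * Real.exp (-ρ / (2 * v)) * (γ - α) := by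
    have : γ - α = κ * (β - α) := by rw [hγdef]; ring
    rw [this, mul_assoc, mul_assoc, ← mul_assoc (Real.exp _)]
    gcongr
    linarith
  obtain ⟨c, hTc, hcG⟩ := exists_between hT
  have hT0 : 0 < K * Real.exp (-1) * (β - α) := by positivity
  have hc0 : 0 < c := hT0.trans hTc
  have hclt : ENNReal.ofReal c < gaussianReal 0 v.toNNReal (Set.Ioo α γ) :=
    ((ENNReal.ofReal_lt_ofReal_iff (hc0.trans hcG)).2 hcG).trans_le hmass
  have htail : Filter.Tendsto (fun n : ℕ => (1 - Real.exp (-((β - γ) * √n))) * c) Filter.atTop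
      (nhds ((1 - 0) * c)) := by
    refine (tendsto_const_nhds.sub ?_).mul_const c
    refine Real.tendsto_exp_neg_atTop_nhds_zero.comp ?_
    exact (Real.tendsto_sqrt_atTop.comp tendsto_natCast_atTop_atTop).const_mul_atTop
      (sub_pos.2 hγβ)
  rw [sub_zero, one_mul] at htail
  filter_upwards [eventually_lt_pi_gibbsMeasure_window hV α γ hclt,
    htail.eventually_const_lt hTc] with n hn hn'
  have hu : 0 ≤ (β - γ) * √(n : ℝ) := mul_nonneg (sub_pos.2 hγβ).le (Real.sqrt_nonneg _)
  have hwin := pi_gibbsMeasure_le_setLIntegral hV.continuous.measurable n (m * n + α * √n)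
    (m * n + β * √n) hu
  rw [show m * n + β * √n - (β - γ) * √n = m * n + γ * √n by ring] at hwin
  refine le_trans ?_ hwin
  calc _ ≤ ENNReal.ofReal ((1 - Real.exp (-((β - γ) * √n))) * c) :=
        ENNReal.ofReal_le_ofReal hn'.le
    _ = ENNReal.ofReal (1 - Real.exp (-((β - γ) * √n))) * ENNReal.ofReal c := by
        rw [ENNReal.ofReal_mul (by simpa using hu)]
    _ ≤ _ := by gcongr

/-! ### Comparison with the level -/

theorem pow_mul_exp_neg_div_factorial_le {n : ℕ} (hn : 0 < n) :
    (n : ℝ) ^ n * Real.exp (-(n : ℝ)) / (n.factorial : ℝ) ≤ (√(2 * Real.pi * n))⁻¹ := by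
  have h := Stirling.le_factorial_stirling n
  rw [div_pow, ← Real.exp_nat_mul, mul_one] at h
  rw [div_le_iff₀ (by positivity), inv_mul_eq_div, le_div_iff₀ (by positivity), Real.exp_neg,
    ← div_eq_mul_inv, mul_comm]
  exact h

theorem mem_levelSet_iff {V : ℝ → ℝ} (hV : IsYoungFunction V) {n : ℕ} {E : ℝ} :
    E ∈ levelSet V n ↔ ENNReal.ofReal (1 / Real.exp 1 *
      ((n : ℝ) ^ n * Real.exp (-(n : ℝ)) / (n.factorial : ℝ))) ≤ volumeDensity V n E := by
  refine ⟨fun h => h.2, fun h => ⟨?_, h⟩⟩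
  -- an Orlicz ball of negative energy is empty, while the level is positive
  by_contra hE
  have hempty : orliczBall V n E = ∅ := Set.eq_empty_of_forall_notMem fun x hx =>
    hE ((Finset.sum_nonneg fun i _ => hV.nonneg (x i)).trans hx)
  have hn : 0 < (n : ℝ) ^ n := by exact_mod_cast Nat.pow_self_pos
  rw [volumeDensity, hempty, measure_empty, mul_zero, nonpos_iff_eq_zero,
    ENNReal.ofReal_eq_zero] at h
  exact absurd h (not_le.2 (by positivity))

theorem mainTheorem6 (V : ℝ → ℝ) (hV : IsYoungFunction V)
    (hμ : IsProbabilityMeasure (gibbsMeasure V))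
    (m₁ σ₁ : ℝ) (hm₁ : m₁ = ∫ x, V x ∂(gibbsMeasure V))
    (hσ₁ : σ₁ = Real.sqrt (variance V (gibbsMeasure V)))
    (ε : ℝ) (hε : ε ∈ Set.Ioo (0 : ℝ) 1) :
    ∃ n₀ : ℕ, ∀ n : ℕ, n₀ ≤ n →
      Set.Icc (m₁ * n - σ₁ * (1 - ε) * Real.sqrt (2 * n))
          (m₁ * n + σ₁ * (1 - ε) * Real.sqrt (2 * n))
        ⊆ levelSet V n := by
  obtain ⟨hε0, hε1⟩ := hε
  have hv := variance_gibbsMeasure_pos hV hμ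
  have hv1 := variance_gibbsMeasure_le_one hV hμ
  have hσ : 0 < σ₁ := hσ₁ ▸ Real.sqrt_pos.2 hv
  have hσsq : σ₁ ^ 2 = variance V (gibbsMeasure V) := hσ₁ ▸ Real.sq_sqrt hv.le
  -- the rescaled target is `[-s, s]`, flanked by the windows `[-r, -s]` and `[s, r]`
  set s := σ₁ * (1 - ε) * √2 with hs
  set r := σ₁ * (1 - ε / 2) * √2 with hr
  have h2 : √2 ^ 2 = (2 : ℝ) := Real.sq_sqrt (by norm_num)
  have hs0 : 0 < s := by have : 0 < 1 - ε := by linarith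
                         positivity
  have hsr : s < r := by rw [hs, hr]; gcongr; linarith
  have hr2 : r ^ 2 < 2 * variance V (gibbsMeasure V) := by
    rw [hr, mul_pow, mul_pow, h2, hσsq]
    have : (1 - ε / 2) ^ 2 < 1 := by nlinarith
    nlinarith
  have hsr2 : s ^ 2 ≤ r ^ 2 := by gcongr
  have hleft := eventually_le_setLIntegral_volumeDensity hV (neg_lt_neg hsr) (by rw [neg_sq])
    (by rwa [neg_sq]) hr2
  have hright := eventually_le_setLIntegral_volumeDensity hV hsr hsr2 le_rfl hr2
  rw [← hm₁] at hleft hright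
  obtain ⟨n₀, hn₀⟩ := Filter.eventually_atTop.1
    ((hleft.and hright).and (Filter.eventually_gt_atTop 0))
  refine ⟨n₀, fun n hn E hE => ?_⟩
  obtain ⟨⟨hl, hr'⟩, hnpos⟩ := hn₀ n hn
  have hsn : 0 < √(n : ℝ) := by positivity
  have hwidth : σ₁ * (1 - ε) * √(2 * n) = s * √n := by
    rw [Real.sqrt_mul (by norm_num), hs]; ring
  rw [hwidth] at hE
  set v := variance V (gibbsMeasure V)
  rw [mem_levelSet_iff hV]
  calc ENNReal.ofReal (1 / Real.exp 1 *
        ((n : ℝ) ^ n * Real.exp (-(n : ℝ)) / (n.factorial : ℝ)))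
      ≤ ENNReal.ofReal ((√(2 * Real.pi * v))⁻¹ * Real.exp (-1) / √n) := by
        refine ENNReal.ofReal_le_ofReal ?_
        calc _ ≤ 1 / Real.exp 1 * (√(2 * Real.pi * n))⁻¹ := by
              gcongr; exact pow_mul_exp_neg_div_factorial_le hnpos
          _ = (√(2 * Real.pi))⁻¹ * Real.exp (-1) / √n := by
              rw [Real.sqrt_mul (by positivity), Real.exp_neg]; field_simp
          _ ≤ _ := by
              have : 2 * Real.pi * v ≤ 2 * Real.pi :=
                mul_le_of_le_one_right (by positivity) hv1
              gcongr
    _ ≤ volumeDensity V n E := by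
        have scale : ∀ d : ℝ, ENNReal.ofReal ((√(2 * Real.pi * v))⁻¹ * Real.exp (-1) / √n)
            * ENNReal.ofReal (d * √n)
            = ENNReal.ofReal ((√(2 * Real.pi * v))⁻¹ * Real.exp (-1) * d) := by
          intro d
          rw [← ENNReal.ofReal_mul (by positivity)]
          congr 1
          field_simp
        refine le_volumeDensity_of_le_setLIntegral hV hμ n (p := m₁ * n + -r * √n)
          (p' := m₁ * n + -s * √n) (q' := m₁ * n + s * √n) (q := m₁ * n + r * √n)
          (by gcongr) (by linarith [hE.1]) hE.2 (by gcongr) ?_ ?_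
        · rw [show m₁ * n + -s * √n - (m₁ * n + -r * √n) = (-s - -r) * √n by ring, scale]
          exact hl
        · rw [show m₁ * n + r * √n - (m₁ * n + s * √n) = (r - s) * √n by ring, scale]
          exact hr'
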